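/- In the context of profinite groups all group-theoretic notions are interpreted topologically: subgroups are closed, quotients are taken by closed normal subgroups, and isomorphisms are isomorphisms of topological groups. Multilinear commutator words are defined recursively: a single variable $x$ is a multilinear commutator, and if $u$ and $v$ are multilinear commutators involving disjoint sets of variables, then so is $[u,v]=u^{-1}v^{-1}uv$. For a word $w$ and a profinite group $G$, a $w$-value in $G$ is an element obtained by substituting elements of $G$ for the variables of $w$, and the verbal subgroup $w(G)$ is the smallest closed subgroup of $G$ containing all $w$-values. **Theorem.** Let $\mathcal C$ be a class of profinite groups (closed under isomorphisms) that is closed under taking closed subgroups and quotients by closed normal subgroups, and such that in any profinite group the product of finitely many (at least one) closed normal $\mathcal C$-subgroups is again a $\mathcal C$-subgroup. (For instance, $\mathcal C$ may consist of the profinite groups that belong to a class of abstract groups closed under subgroups, quotients and products of finitely many normal subgroups.) Let $w$ be a multilinear commutator word and let $G$ be a profinite group. Then $w(G)$ is virtually-$\mathcal C$, i.e. $w(G)$ has a closed normal $\mathcal C$-subgroup of finite index (equivalently, an open normal $\mathcal C$-subgroup), if and only if there are countably many closed subgroups $G_1,G_2,\dots$ of $G$ belonging to $\mathcal C$ and elements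 $g_1,g_2,\dots\in G$ such that every $w$-value in $G$ lies in $\bigcup_{i} g_iG_i$. -/

import Mathlib

open scoped Pointwise

universe u

namespace ProfiniteCosets

/-- `IsMultilinearCommutatorIn s w`: the word `w` (an element of the free group on the variables
`x₀, x₁, …`) is a multilinear commutator whose set of variables is `s`.  A single variable is one,
and so is `[u, v] = u⁻¹ v⁻¹ u v` when `u`, `v` are multilinear commutators involving different
variables. -/
inductive IsMultilinearCommutatorIn : Finset ℕ → FreeGroup ℕ → Prop
  | var (i : ℕ) : IsMultilinearCommutatorIn {i} (FreeGroup.of i)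
  | comm {s t : Finset ℕ} {u v : FreeGroup ℕ} (hu : IsMultilinearCommutatorIn s u)
      (hv : IsMultilinearCommutatorIn t v) (hst : Disjoint s t) :
      IsMultilinearCommutatorIn (s ∪ t) (u⁻¹ * v⁻¹ * u * v)

/-- The word `w` is a multilinear commutator. -/
def IsMultilinearCommutator (w : FreeGroup ℕ) : Prop :=
  ∃ s : Finset ℕ, IsMultilinearCommutatorIn s w

/-- The set of `w`-values in the group `G`: all elements obtained by substituting elements of `G`
for the variables of `w`. -/
def wordValues (w : FreeGroup ℕ) (G : Type u) [Group G] : Set G :=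
  {g : G | ∃ a : ℕ → G, FreeGroup.lift a w = g}

/-- The verbal subgroup `w(G)` of a topological group: the smallest closed subgroup containing all
`w`-values. -/
def verbalSubgroup (w : FreeGroup ℕ) (G : Type u) [Group G] [TopologicalSpace G]
    [IsTopologicalGroup G] : Subgroup G :=
  (Subgroup.closure (wordValues w G)).topologicalClosure

/-- A property of groups endowed with a topology; it is only ever used for profinite groups. -/
abbrev GroupClass : Type (u + 1) :=
  (G : Type u) → [Group G] → [TopologicalSpace G] → Prop

/-- `C` is a class of profinite groups (so it is invariant under isomorphisms of topological
groups) which is closed under subgroups and quotients and such that in any profinite group the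
product of finitely many normal `C`-subgroups is a `C`-subgroup.  Subgroups of profinite groups are
closed subgroups.  The product of finitely many (at least one) factors reduces to that of two, and
the product set of two normal subgroups `M`, `N` is the subgroup `M ⊔ N`. -/
structure GroupClass.IsAdmissible (C : GroupClass.{u}) : Prop where
  iso : ∀ (G H : Type u) [Group G] [TopologicalSpace G] [IsTopologicalGroup G] [CompactSpace G]
    [TotallyDisconnectedSpace G] [Group H] [TopologicalSpace H] [IsTopologicalGroup H]
    [CompactSpace H] [TotallyDisconnectedSpace H], (G ≃ₜ* H) → C G → C H
  subgroup : ∀ (G : Type u) [Group G] [TopologicalSpace G] [IsTopologicalGroup G] [CompactSpace G]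
    [TotallyDisconnectedSpace G] (H : Subgroup G), IsClosed (H : Set G) → C G → C H
  quotient : ∀ (G : Type u) [Group G] [TopologicalSpace G] [IsTopologicalGroup G] [CompactSpace G]
    [TotallyDisconnectedSpace G] (N : Subgroup G) [N.Normal], IsClosed (N : Set G) →
    C G → C (G ⧸ N)
  product : ∀ (G : Type u) [Group G] [TopologicalSpace G] [IsTopologicalGroup G] [CompactSpace G]
    [TotallyDisconnectedSpace G] (M N : Subgroup G), M.Normal → N.Normal →
    IsClosed (M : Set G) → IsClosed (N : Set G) → C M → C N → C (M ⊔ N : Subgroup G)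

/-- `G` is virtually-`C`: it has a (closed) normal `C`-subgroup of finite index. -/
def GroupClass.Virtually (C : GroupClass.{u}) (G : Type u) [Group G] [TopologicalSpace G] : Prop :=
  ∃ N : Subgroup G, N.Normal ∧ IsClosed (N : Set G) ∧ N.FiniteIndex ∧ C N

/-- The subset `S` of `G` is covered by countably many cosets `gᵢ Gᵢ` of (closed) `C`-subgroups
of `G`. -/
def GroupClass.CountablyCovers (C : GroupClass.{u}) {G : Type u} [Group G] [TopologicalSpace G]
    (S : Set G) : Prop :=
  ∃ (g : ℕ → G) (K : ℕ → Subgroup G),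
    (∀ i, IsClosed (K i : Set G)) ∧ (∀ i, C (K i)) ∧ S ⊆ ⋃ i, g i • (K i : Set G)

end ProfiniteCosets

/-!
The easy direction: if `N` is a normal `C`-subgroup of finite index in `w(G)`, the values lie in
finitely many cosets of `N`.

For the converse, let the `w`-values be covered by countably many cosets of closed `C`-subgroups.
By Baire's theorem (`IsMultilinearCommutatorIn.exists_coset`) every coset of an open subgroup in the
space of tuples contains a coset `(a₁L, …, aₙL)`, with `L` open and normal, on which `w`
takes values in one coset `gK` of a `C`-subgroup `K`.  The identities
`[x, y]⁻¹[x, y'] = [x^y, y⁻¹y']` and `[x, y]⁻¹[x', y] = [x⁻¹x', y^x]^[x, y]` show that an entry `aᵢ`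
of the representative can be replaced by `1`, at the cost of conjugating `K` and the other `aⱼ`
(`IsMultilinearCommutatorIn.exists_remove`).  The values on the new coset lie in the `C`-subgroup
itself, and if some entry runs through `L`, they generate a subgroup of `L` normalized by `L`.
Finitely many such subgroups, together with subgroups obtained inductively, generate the subgroup
`w(G, …, L, …, G)`, with `L` in any given nonempty set of positions, which is therefore a
`C`-subgroup for a suitable `L` (`IsMultilinearCommutatorIn.exists_open_normal`).

Let `N` be the product of these subgroups for the single positions.  It is a normal `C`-subgroup,
and modulo `N` every `w`-value with an entry in `L` is trivial.  It remains to see that `w(G)` is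
finite in this situation (`IsMultilinearCommutatorIn.finite_closure_wordValues`).  There are
finitely many values and `L` centralizes them, so `w(G)` has finite commutator subgroup by Schur's
theorem, and one may take `w(G)` to be commutative.  Since `w(G)` contains a term of the derived
series, `G` is then soluble.  Consider values with entries in prescribed terms of the derived
series.  By descending induction on the total depth one may assume that the deeper values have
finite order; modulo these, `w` is linear in the position of the deepest entry, so the values have
finite order because their powers of exponent `|G : L|` are trivial.
-/

namespace ProfiniteCosets

/-! ### Values of multilinear commutators -/

section Words

variable {G Q : Type*} [Group G] [Group Q]

theorem map_lift_apply (f : G →* Q) (c : ℕ → G) (w : FreeGroup ℕ) :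
    f (FreeGroup.lift c w) = FreeGroup.lift (fun j => f (c j)) w := by
  have : f.comp (FreeGroup.lift c) = FreeGroup.lift (fun j => f (c j)) := by
    ext j; simp
  exact DFunLike.congr_fun this w

theorem lift_conj (c : ℕ → G) (d : G) (w : FreeGroup ℕ) :
    FreeGroup.lift (fun j => d⁻¹ * c j * d) w = d⁻¹ * FreeGroup.lift c w * d := by
  have h := map_lift_apply (MulAut.conj d⁻¹).toMonoidHom c w
  simpa using h.symm

theorem lift_commutatorWord (c : ℕ → G) (u v : FreeGroup ℕ) :
    FreeGroup.lift c (u⁻¹ * v⁻¹ * u * v) = (FreeGroup.lift c u)⁻¹ * (FreeGroup.lift c v)⁻¹ *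
      FreeGroup.lift c u * FreeGroup.lift c v := by
  simp

variable {s : Finset ℕ} {w : FreeGroup ℕ}

/-- The value of a multilinear commutator depends only on the values of its own variables. -/
theorem IsMultilinearCommutatorIn.lift_congr (hw : IsMultilinearCommutatorIn s w) {c c' : ℕ → G}
    (h : ∀ j ∈ s, c j = c' j) : FreeGroup.lift c w = FreeGroup.lift c' w := by
  induction hw with
  | var i => simpa using h i
  | comm hu hv hst ihu ihv =>
    rw [lift_commutatorWord, lift_commutatorWord,
      ihu fun j hj => h j (Finset.mem_union_left _ hj),
      ihv fun j hj => h j (Finset.mem_union_right _ hj)]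

theorem IsMultilinearCommutatorIn.nonempty (hw : IsMultilinearCommutatorIn s w) :
    s.Nonempty := by
  induction hw with
  | var i => simp
  | comm hu hv hst ihu ihv => exact ihu.mono Finset.subset_union_left

/-- If one variable of a multilinear commutator is specialized into a normal subgroup, so is the
value. -/
theorem IsMultilinearCommutatorIn.lift_mem (hw : IsMultilinearCommutatorIn s w) {M : Subgroup G}
    (hM : M.Normal) {k : ℕ} (hk : k ∈ s) {c : ℕ → G} (hc : c k ∈ M) :
    FreeGroup.lift c w ∈ M := by
  induction hw with
  | var i =>
    obtain rfl : k = i := by simpa using hk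
    simpa using hc
  | @comm s t u v hu hv hst ihu ihv =>
    rw [lift_commutatorWord]
    rcases Finset.mem_union.1 hk with hk | hk
    · have := M.mul_mem (M.inv_mem (ihu hk)) (hM.conj_mem _ (ihu hk) (FreeGroup.lift c v)⁻¹)
      simpa [mul_assoc] using this
    · have := M.mul_mem (hM.conj_mem _ (M.inv_mem (ihv hk)) (FreeGroup.lift c u)⁻¹) (ihv hk)
      simpa [mul_assoc] using this

/-- Changing the entry in position `k` of a multilinear commutator multiplies its value on the
right by another value, whose entries are conjugates of the old ones, except in position `k`, where
there is a conjugate of the change.  If the entries in position `k` belong to a normal subgroup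
`M`, then one can conjugate by elements of `M`. -/
theorem IsMultilinearCommutatorIn.exists_inv_mul_eq (hw : IsMultilinearCommutatorIn s w)
    {M : Subgroup G} (hM : M.Normal) {k : ℕ} (hk : k ∈ s) {c c' : ℕ → G}
    (hcc' : ∀ j, j ≠ k → c j = c' j) (hc : c k ∈ M) :
    ∃ d e : ℕ → G, (∀ j, d j ∈ M) ∧ e k = (d k)⁻¹ * ((c k)⁻¹ * c' k) * d k ∧
      (∀ j, j ≠ k → e j = (d j)⁻¹ * c j * d j) ∧
      (FreeGroup.lift c w)⁻¹ * FreeGroup.lift c' w = FreeGroup.lift e w := by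
  induction hw with
  | var i =>
    obtain rfl : k = i := by simpa using hk
    exact ⟨fun _ => 1, Function.update c k ((c k)⁻¹ * c' k), fun _ => M.one_mem, by simp,
      fun j hj => by simp [hj], by simp⟩
  | @comm s t u v hu hv hst ihu ihv =>
    rcases Finset.mem_union.1 hk with hk | hk
    · have hkt : k ∉ t := Finset.disjoint_left.1 hst hk
      obtain ⟨d, e, hd, hek, hej, he⟩ := ihu hk
      have hv' : FreeGroup.lift c' v = FreeGroup.lift c v :=
        hv.lift_congr fun j hj => (hcc' j fun h => hkt (h ▸ hj)).symm
      have hxM : FreeGroup.lift c u ∈ M := hu.lift_mem hM hk hc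
      set x := FreeGroup.lift c u with hx
      set y := FreeGroup.lift c v with hy
      have hqM : x⁻¹ * y⁻¹ * x * y ∈ M := by
        have := (hu.comm hv hst).lift_mem hM (Finset.mem_union_left _ hk) hc
        rwa [lift_commutatorWord] at this
      set q := x⁻¹ * y⁻¹ * x * y with hq
      -- Here `[x, y]⁻¹[x', y] = [x⁻¹x', y^x]^q` with `q = [x, y]`.
      refine ⟨fun j => (if j ∈ t then x else d j) * q,
        fun j => q⁻¹ * (if j ∈ t then x⁻¹ * c j * x else e j) * q, fun j => ?_, ?_, ?_, ?_⟩
      · dsimp only; split_ifs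
        · exact M.mul_mem hxM hqM
        · exact M.mul_mem (hd j) hqM
      · simp [hkt, hek, mul_assoc]
      · intro j hj
        by_cases h : j ∈ t <;> simp [h, hej j hj, mul_assoc]
      · have e1 : FreeGroup.lift (fun j => if j ∈ t then x⁻¹ * c j * x else e j) u =
            FreeGroup.lift e u :=
          hu.lift_congr fun j hj => by simp [Finset.disjoint_left.1 hst hj]
        have e2 : FreeGroup.lift (fun j => if j ∈ t then x⁻¹ * c j * x else e j) v =
            x⁻¹ * y * x :=
          (hv.lift_congr fun j hj => by simp [hj]).trans (lift_conj c x v)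
        rw [lift_conj]
        simp only [lift_commutatorWord, e1, e2, ← he, hv', ← hx, ← hy, hq]
        group
    · have hks : k ∉ s := Finset.disjoint_right.1 hst hk
      obtain ⟨d, e, hd, hek, hej, he⟩ := ihv hk
      have hu' : FreeGroup.lift c' u = FreeGroup.lift c u :=
        hu.lift_congr fun j hj => (hcc' j fun h => hks (h ▸ hj)).symm
      have hyM : FreeGroup.lift c v ∈ M := hv.lift_mem hM hk hc
      set x := FreeGroup.lift c u with hx
      set y := FreeGroup.lift c v with hy
      -- Here `[x, y]⁻¹[x, y'] = [x^y, y⁻¹y']`.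
      refine ⟨fun j => if j ∈ s then y else d j,
        fun j => if j ∈ s then y⁻¹ * c j * y else e j, fun j => ?_, ?_, ?_, ?_⟩
      · dsimp only; split_ifs
        · exact hyM
        · exact hd j
      · simp [hks, hek]
      · intro j hj
        by_cases h : j ∈ s <;> simp [h, hej j hj]
      · have e1 : FreeGroup.lift (fun j => if j ∈ s then y⁻¹ * c j * y else e j) v =
            FreeGroup.lift e v :=
          hv.lift_congr fun j hj => by simp [Finset.disjoint_right.1 hst hj]
        have e2 : FreeGroup.lift (fun j => if j ∈ s then y⁻¹ * c j * y else e j) u =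
            y⁻¹ * x * y :=
          (hu.lift_congr fun j hj => by simp [hj]).trans (lift_conj c y u)
        simp only [lift_commutatorWord, e1, e2, ← he, hu', ← hx, ← hy]
        group

/-- If a multilinear commutator takes values in `T` as soon as one of its entries, in position `j`,
lies in `E j`, then modulo `T` its value depends only on the entries modulo the `E j`. -/
theorem IsMultilinearCommutatorIn.inv_mul_mem_of_forall (hw : IsMultilinearCommutatorIn s w)
    {D E : ℕ → Subgroup G} {T : Subgroup G} (hD : ∀ j, (D j).Normal) (hE : ∀ j, (E j).Normal)
    (hT : ∀ j ∈ s, ∀ c : ℕ → G, (∀ i, c i ∈ D i) → c j ∈ E j → FreeGroup.lift c w ∈ T)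
    {c c' : ℕ → G} (hc : ∀ j, c j ∈ D j) (hc' : ∀ j, c' j ∈ D j)
    (hcc' : ∀ j ∈ s, (c j)⁻¹ * c' j ∈ E j) :
    (FreeGroup.lift c w)⁻¹ * FreeGroup.lift c' w ∈ T := by
  classical
  have key : ∀ F : Finset ℕ, F ⊆ s →
      (FreeGroup.lift c w)⁻¹ * FreeGroup.lift (F.piecewise c' c) w ∈ T := by
    intro F
    induction F using Finset.induction_on with
    | empty => intro _; simp [T.one_mem]
    | insert k F hkF ih =>
      intro hF
      have hks : k ∈ s := hF (Finset.mem_insert_self _ _)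
      have h1 := ih fun j hj => hF (Finset.mem_insert_of_mem hj)
      obtain ⟨d, e, -, hek, hej, he⟩ := hw.exists_inv_mul_eq (M := ⊤) inferInstance hks
        (c := F.piecewise c' c) (c' := (insert k F).piecewise c' c)
        (fun j hj => by simp [Finset.piecewise, hj]) trivial
      have hpD : ∀ j, F.piecewise c' c j ∈ D j := fun j => by
        by_cases h : j ∈ F <;> simp [h, hc, hc']
      have hek' : e k = (d k)⁻¹ * ((c k)⁻¹ * c' k) * d k := by simpa [hkF] using hek
      have h2 : FreeGroup.lift e w ∈ T := by
        refine hT k hks e (fun i => ?_) ?_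
        · by_cases hi : i = k
          · subst hi
            rw [hek']
            simpa using (hD i).conj_mem _ ((D i).mul_mem ((D i).inv_mem (hc i)) (hc' i)) (d i)⁻¹
          · rw [hej i hi]
            simpa using (hD i).conj_mem _ (hpD i) (d i)⁻¹
        · rw [hek']
          simpa using (hE k).conj_mem _ (hcc' k hks) (d k)⁻¹
      rw [← he] at h2
      simpa [mul_assoc] using T.mul_mem h1 h2
  have hs : FreeGroup.lift (s.piecewise c' c) w = FreeGroup.lift c' w :=
    hw.lift_congr fun j hj => by simp [hj]
  exact hs ▸ key s subset_rfl

/-- Removal of a coset representative.  The values of a multilinear commutator at tuples `c` with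
`π (c j) = a' j` for all `j`, where `a' k = 1`, are, up to conjugation, quotients of values at
tuples in the cosets of `ker π` given by `a`.  Here `a'` agrees with `a` outside the position `k`
up to conjugation by elements of `M`.  The conjugator `g` depends on `c`, but it stays in a fixed
coset of `ker π`. -/
theorem IsMultilinearCommutatorIn.exists_coset_tuple (hw : IsMultilinearCommutatorIn s w)
    (π : G →* Q) (hπ : Function.Surjective π) {M : Subgroup Q} (hM : M.Normal) {k : ℕ}
    (hk : k ∈ s) (a : ℕ → Q) (ha : a k ∈ M) :
    ∃ (a' d : ℕ → Q) (e : Q), e ∈ M ∧ (∀ j, d j ∈ M) ∧ a' k = 1 ∧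
      (∀ j, j ≠ k → a' j = (d j)⁻¹ * a j * d j) ∧
      ∀ c : ℕ → G, (∀ j, π (c j) = a' j) → ∃ (c₁ c₂ : ℕ → G) (g : G), (∀ j, π (c₁ j) = a j) ∧
        (∀ j, π (c₂ j) = a j) ∧ π g = e ∧
        (FreeGroup.lift c₁ w)⁻¹ * FreeGroup.lift c₂ w = g⁻¹ * FreeGroup.lift c w * g := by
  classical
  induction hw with
  | var i =>
    obtain rfl : k = i := by simpa using hk
    choose r hr using hπ
    refine ⟨Function.update a k 1, fun _ => 1, 1, M.one_mem, fun _ => M.one_mem, by simp,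
      fun j hj => by simp [hj], fun c hc => ?_⟩
    refine ⟨fun j => r (a j), fun j => if j = k then r (a k) * c k else r (a j), 1,
      fun j => hr _, fun j => ?_, by simp, by simp⟩
    by_cases h : j = k
    · subst h; simp [hr, hc]
    · simp [h, hr]
  | @comm s t u v hu hv hst ihu ihv =>
    rcases Finset.mem_union.1 hk with hk | hk
    · have hkt : k ∉ t := Finset.disjoint_left.1 hst hk
      obtain ⟨a', d, e, he, hd, hk1, haj, H⟩ := ihu hk
      set x₀ := FreeGroup.lift a u with hx₀
      set y₀ := FreeGroup.lift a v with hy₀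
      have hxM : x₀ ∈ M := hu.lift_mem hM hk ha
      have hqM : x₀⁻¹ * y₀⁻¹ * x₀ * y₀ ∈ M := by
        have := (hu.comm hv hst).lift_mem hM (Finset.mem_union_left _ hk) ha
        rwa [lift_commutatorWord] at this
      refine ⟨fun j => if j ∈ t then (x₀ * e⁻¹)⁻¹ * a j * (x₀ * e⁻¹) else a' j,
        fun j => if j ∈ t then x₀ * e⁻¹ else d j, e * (x₀⁻¹ * y₀⁻¹ * x₀ * y₀),
        M.mul_mem he hqM, fun j => ?_, by simp [hkt, hk1], fun j hj => ?_, fun c hc => ?_⟩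
      · dsimp only; split_ifs
        · exact M.mul_mem hxM (M.inv_mem he)
        · exact hd j
      · by_cases h : j ∈ t <;> simp [h, haj j hj]
      · obtain ⟨r, hr⟩ := hπ.comp_left (α := ℕ) a'
        obtain ⟨c₁, c₂, g, hc₁, hc₂, hg, h⟩ := H (fun j => if j ∈ t then r j else c j) fun j => by
          by_cases h : j ∈ t
          · simpa [h] using congrFun hr j
          · simp [h, hc]
        set x := FreeGroup.lift c₁ u with hx
        have hπx : π x = x₀ := by
          rw [hx, map_lift_apply]; exact congrArg (fun f => FreeGroup.lift f u) (funext hc₁)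
        -- The entries in the positions of `v` are chosen so that the conjugations cancel.
        set y : ℕ → G := fun j => (g * x⁻¹)⁻¹ * c j * (g * x⁻¹) with hy
        have hyπ : ∀ j ∈ t, π (y j) = a j := fun j hj => by
          simp [hy, hg, hπx, hc, hj, mul_assoc]
        have hπy : π (FreeGroup.lift y v) = y₀ := by
          rw [map_lift_apply]; exact hv.lift_congr hyπ
        refine ⟨fun j => if j ∈ t then y j else c₁ j, fun j => if j ∈ t then y j else c₂ j,
          g * (x⁻¹ * (FreeGroup.lift y v)⁻¹ * x * FreeGroup.lift y v),
          fun j => ?_, fun j => ?_, by simp [hg, hπx, hπy], ?_⟩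
        · by_cases h : j ∈ t
          · simpa [h] using hyπ j h
          · simp [h, hc₁]
        · by_cases h : j ∈ t
          · simpa [h] using hyπ j h
          · simp [h, hc₂]
        · have e1 : ∀ c₁ : ℕ → G, FreeGroup.lift (fun j => if j ∈ t then y j else c₁ j) u =
              FreeGroup.lift c₁ u := fun c₁ =>
            hu.lift_congr fun j hj => by simp [Finset.disjoint_left.1 hst hj]
          have e2 : ∀ c₁ : ℕ → G, FreeGroup.lift (fun j => if j ∈ t then y j else c₁ j) v =
              FreeGroup.lift y v := fun c₁ => hv.lift_congr fun j hj => by simp [hj]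
          have e3 : FreeGroup.lift (fun j => if j ∈ t then r j else c j) u = FreeGroup.lift c u :=
            hu.lift_congr fun j hj => by simp [Finset.disjoint_left.1 hst hj]
          have e4 : FreeGroup.lift c₂ u = x * (g⁻¹ * FreeGroup.lift c u * g) := by
            rw [← e3, ← h]; simp
          have e5 : FreeGroup.lift y v = (g * x⁻¹)⁻¹ * FreeGroup.lift c v * (g * x⁻¹) :=
            lift_conj _ _ _
          simp only [lift_commutatorWord, e1, e2]
          rw [e4, e5, ← hx]
          group
    · have hks : k ∉ s := Finset.disjoint_right.1 hst hk
      obtain ⟨a', d, e, he, hd, hk1, haj, H⟩ := ihv hk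
      set y₀ := FreeGroup.lift a v with hy₀
      have hyM : y₀ ∈ M := hv.lift_mem hM hk ha
      refine ⟨fun j => if j ∈ s then (y₀ * e⁻¹)⁻¹ * a j * (y₀ * e⁻¹) else a' j,
        fun j => if j ∈ s then y₀ * e⁻¹ else d j, e,
        he, fun j => ?_, by simp [hks, hk1], fun j hj => ?_, fun c hc => ?_⟩
      · dsimp only; split_ifs
        · exact M.mul_mem hyM (M.inv_mem he)
        · exact hd j
      · by_cases h : j ∈ s <;> simp [h, haj j hj]
      · obtain ⟨r, hr⟩ := hπ.comp_left (α := ℕ) a'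
        obtain ⟨c₁, c₂, g, hc₁, hc₂, hg, h⟩ := H (fun j => if j ∈ s then r j else c j) fun j => by
          by_cases h : j ∈ s
          · simpa [h] using congrFun hr j
          · simp [h, hc]
        set y := FreeGroup.lift c₁ v with hy
        have hπy : π y = y₀ := by
          rw [hy, map_lift_apply]; exact congrArg (fun f => FreeGroup.lift f v) (funext hc₁)
        -- The entries in the positions of `u` are chosen so that the conjugations cancel.
        set x : ℕ → G := fun j => (g * y⁻¹)⁻¹ * c j * (g * y⁻¹) with hx
        have hxπ : ∀ j ∈ s, π (x j) = a j := fun j hj => by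
          simp [hx, hg, hπy, hc, hj, mul_assoc]
        refine ⟨fun j => if j ∈ s then x j else c₁ j, fun j => if j ∈ s then x j else c₂ j,
          g, fun j => ?_, fun j => ?_, hg, ?_⟩
        · by_cases h : j ∈ s
          · simpa [h] using hxπ j h
          · simp [h, hc₁]
        · by_cases h : j ∈ s
          · simpa [h] using hxπ j h
          · simp [h, hc₂]
        · have e1 : ∀ c₁ : ℕ → G, FreeGroup.lift (fun j => if j ∈ s then x j else c₁ j) v =
              FreeGroup.lift c₁ v := fun c₁ =>
            hv.lift_congr fun j hj => by simp [Finset.disjoint_right.1 hst hj]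
          have e2 : ∀ c₁ : ℕ → G, FreeGroup.lift (fun j => if j ∈ s then x j else c₁ j) u =
              FreeGroup.lift x u := fun c₁ => hu.lift_congr fun j hj => by simp [hj]
          have e3 : FreeGroup.lift (fun j => if j ∈ s then r j else c j) v = FreeGroup.lift c v :=
            hv.lift_congr fun j hj => by simp [Finset.disjoint_right.1 hst hj]
          have e4 : FreeGroup.lift c₂ v = y * (g⁻¹ * FreeGroup.lift c v * g) := by
            rw [← e3, ← h]; simp
          have e5 : FreeGroup.lift x u = (g * y⁻¹)⁻¹ * FreeGroup.lift c u * (g * y⁻¹) :=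
            lift_conj _ _ _
          simp only [lift_commutatorWord, e1, e2]
          rw [e4, e5, ← hy]
          group

end Words

/-! ### Finiteness of the verbal subgroup when a marginal subgroup has finite index -/

section Marginal

open scoped commutatorElement

variable {G Q : Type*} [Group G] [Group Q] {s : Finset ℕ} {w : FreeGroup ℕ}

theorem closure_wordValues_normal (w : FreeGroup ℕ) (G : Type*) [Group G] :
    (Subgroup.closure (wordValues w G)).Normal := by
  refine ⟨fun x hx g => ?_⟩
  induction hx using Subgroup.closure_induction with
  | mem x hx =>
    obtain ⟨c, rfl⟩ := hx
    refine Subgroup.subset_closure ⟨fun j => (g⁻¹)⁻¹ * c j * g⁻¹, ?_⟩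
    rw [lift_conj, inv_inv]
  | one => simp
  | mul x y _ _ hx hy => simpa [mul_assoc] using Subgroup.mul_mem _ hx hy
  | inv x _ hx => simpa [mul_assoc] using Subgroup.inv_mem _ hx

theorem map_closure_wordValues (f : G →* Q) (hf : Function.Surjective f) (w : FreeGroup ℕ) :
    (Subgroup.closure (wordValues w G)).map f = Subgroup.closure (wordValues w Q) := by
  rw [MonoidHom.map_closure]
  congr 1
  ext x
  constructor
  · rintro ⟨_, ⟨c, rfl⟩, rfl⟩
    exact ⟨_, (map_lift_apply f c w).symm⟩
  · rintro ⟨c, rfl⟩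
    obtain ⟨c, rfl⟩ := hf.comp_left (α := ℕ) c
    exact ⟨_, ⟨c, rfl⟩, map_lift_apply f c w⟩

theorem finiteIndex_map {f : G →* Q} (hf : Function.Surjective f) (L : Subgroup G)
    [L.FiniteIndex] : (L.map f).FiniteIndex :=
  ⟨fun h => Subgroup.FiniteIndex.index_ne_zero (H := L)
    (Nat.eq_zero_of_zero_dvd (h ▸ Subgroup.index_map_dvd L hf))⟩

theorem exists_lift_tuple {f : G →* Q} (hf : Function.Surjective f) {L : Subgroup G}
    {c : ℕ → Q} {k : ℕ} (hc : c k ∈ L.map f) :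
    ∃ c' : ℕ → G, c' k ∈ L ∧ (fun j => f (c' j)) = c := by
  classical
  obtain ⟨l, hl, hlc⟩ := hc
  choose r hr using hf
  refine ⟨Function.update (fun j => r (c j)) k l, by simpa using hl, funext fun j => ?_⟩
  by_cases h : j = k
  · subst h; simpa using hlc
  · simp [h, hr]

/-- The verbal subgroup of a multilinear commutator contains a term of the derived series. -/
theorem IsMultilinearCommutatorIn.exists_derivedSeries_le
    (hw : IsMultilinearCommutatorIn s w) :
    ∃ r, ∀ (G : Type u) [Group G], derivedSeries G r ≤ Subgroup.closure (wordValues w G) := by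
  induction hw with
  | var i =>
    refine ⟨0, fun G _ x _ => Subgroup.subset_closure ⟨fun _ => x, by simp⟩⟩
  | @comm s t u v hu hv hst ihu ihv =>
    obtain ⟨p, hp⟩ := ihu
    obtain ⟨q, hq⟩ := ihv
    refine ⟨max p q + 1, fun G _ => ?_⟩
    set W := Subgroup.closure (wordValues (u⁻¹ * v⁻¹ * u * v) G) with hW
    have hWn : W.Normal := closure_wordValues_normal _ _
    -- Modulo `W` the values of `u` commute with those of `v`, hence so do the verbal subgroups.
    have h1 : ∀ x ∈ wordValues u (G ⧸ W), ∀ y ∈ wordValues v (G ⧸ W), x * y = y * x := by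
      rintro _ ⟨c, rfl⟩ _ ⟨d, rfl⟩
      obtain ⟨c, rfl⟩ := (QuotientGroup.mk'_surjective W).comp_left (α := ℕ) c
      obtain ⟨d, rfl⟩ := (QuotientGroup.mk'_surjective W).comp_left (α := ℕ) d
      have h : FreeGroup.lift (fun j => if j ∈ s then c j else d j) (u⁻¹ * v⁻¹ * u * v) ∈ W :=
        Subgroup.subset_closure ⟨_, rfl⟩
      rw [lift_commutatorWord, hu.lift_congr (c' := c) fun j hj => by simp [hj],
        hv.lift_congr (c' := d) fun j hj => by simp [Finset.disjoint_right.1 hst hj]] at h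
      have h' : QuotientGroup.mk' W (FreeGroup.lift d v * FreeGroup.lift c u) =
          QuotientGroup.mk' W (FreeGroup.lift c u * FreeGroup.lift d v) := by
        refine QuotientGroup.eq.2 ?_
        simpa [mul_assoc] using h
      rw [map_mul, map_mul, map_lift_apply, map_lift_apply] at h'
      exact h'.symm
    have h2 : Subgroup.closure (wordValues u (G ⧸ W)) ≤
        Subgroup.centralizer (Subgroup.closure (wordValues v (G ⧸ W)) : Set (G ⧸ W)) := by
      rw [Subgroup.centralizer_closure, Subgroup.closure_le]
      intro x hx
      exact Subgroup.mem_centralizer_iff.2 fun y hy => (h1 x hx y hy).symm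
    rw [derivedSeries_succ, Subgroup.commutator_le]
    intro x hx y hy
    have hx' := hp G (derivedSeries_antitone G (le_max_left p q) hx)
    have hy' := hq G (derivedSeries_antitone G (le_max_right p q) hy)
    have hx2 : QuotientGroup.mk' W x ∈ Subgroup.closure (wordValues u (G ⧸ W)) := by
      rw [← map_closure_wordValues _ (QuotientGroup.mk'_surjective W)]
      exact Subgroup.mem_map_of_mem _ hx'
    have hy2 : QuotientGroup.mk' W y ∈ Subgroup.closure (wordValues v (G ⧸ W)) := by
      rw [← map_closure_wordValues _ (QuotientGroup.mk'_surjective W)]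
      exact Subgroup.mem_map_of_mem _ hy'
    have h3 := Subgroup.mem_centralizer_iff.1 (h2 hx2) _ hy2
    rw [← QuotientGroup.eq_one_iff]
    change QuotientGroup.mk' W ⁅x, y⁆ = 1
    rw [map_commutatorElement, commutatorElement_eq_one_iff_mul_comm]
    exact h3.symm

/-- A multilinear commutator whose value is trivial as soon as one entry lies in a normal subgroup
`L` of finite index has finitely many values. -/
theorem IsMultilinearCommutatorIn.finite_wordValues (hw : IsMultilinearCommutatorIn s w)
    {L : Subgroup G} (hLn : L.Normal) [L.FiniteIndex]
    (hL : ∀ k ∈ s, ∀ c : ℕ → G, c k ∈ L → FreeGroup.lift c w = 1) :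
    (wordValues w G).Finite := by
  classical
  let f : (s → G ⧸ L) → G := fun τ =>
    FreeGroup.lift (fun j => if h : j ∈ s then (τ ⟨j, h⟩).out else 1) w
  refine (Set.finite_range f).subset ?_
  rintro _ ⟨c, rfl⟩
  refine ⟨fun j => (c j : G ⧸ L), ?_⟩
  refine inv_mul_eq_one.1 (Subgroup.mem_bot.1 ?_)
  refine hw.inv_mul_mem_of_forall (D := fun _ => ⊤) (E := fun _ => L)
    (fun _ => inferInstance) (fun _ => hLn) (fun j hj c _ hc => Subgroup.mem_bot.2 (hL j hj c hc))
    (fun _ => trivial) (fun _ => trivial) (fun j hj => ?_)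
  simp only [hj, dite_true]
  exact QuotientGroup.eq.1 (QuotientGroup.out_eq' _)

/-- If moreover the verbal subgroup is commutative, then it consists of elements of finite order. -/
theorem IsMultilinearCommutatorIn.isOfFinOrder_of_commute (hw : IsMultilinearCommutatorIn s w)
    {G : Type u} [Group G] {L : Subgroup G} (hLn : L.Normal) [L.FiniteIndex]
    (hL : ∀ k ∈ s, ∀ c : ℕ → G, c k ∈ L → FreeGroup.lift c w = 1)
    (hcomm : ∀ x ∈ Subgroup.closure (wordValues w G), ∀ y ∈ Subgroup.closure (wordValues w G),
      Commute x y) (c : ℕ → G) :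
    IsOfFinOrder (FreeGroup.lift c w) := by
  classical
  set W := Subgroup.closure (wordValues w G) with hW
  have hWn : W.Normal := closure_wordValues_normal w G
  -- The torsion subgroup of `W`.
  let N : Subgroup G :=
    { carrier := {x | x ∈ W ∧ IsOfFinOrder x}
      one_mem' := ⟨W.one_mem, IsOfFinOrder.one⟩
      mul_mem' := fun {x y} hx hy =>
        ⟨W.mul_mem hx.1 hy.1, (hcomm x hx.1 y hy.1).isOfFinOrder_mul hx.2 hy.2⟩
      inv_mem' := fun {x} hx => ⟨W.inv_mem hx.1, hx.2.inv⟩ }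
  have hNn : N.Normal :=
    ⟨fun x hx g => ⟨hWn.conj_mem x hx.1 g, (MulAut.conj g).toMonoidHom.isOfFinOrder hx.2⟩⟩
  obtain ⟨r, hr⟩ := hw.exists_derivedSeries_le
  have hD : derivedSeries G (r + 1) = ⊥ := by
    rw [derivedSeries_succ, Subgroup.commutator_eq_bot_iff_le_centralizer]
    exact fun x hx => Subgroup.mem_centralizer_iff.2 fun y hy =>
      (hcomm x (hr G hx) y (hr G hy)).eq.symm
  -- Descending induction on the total depth of the entries in the derived series.
  have key : ∀ (k : ℕ) (i : ℕ → ℕ), s.card * (r + 1) + 1 ≤ k + ∑ j ∈ s, i j →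
      ∀ c : ℕ → G, (∀ j, c j ∈ derivedSeries G (i j)) → FreeGroup.lift c w ∈ N := by
    intro k
    induction k with
    | zero =>
      intro i hi c hc
      obtain ⟨j, hj, hij⟩ : ∃ j ∈ s, r + 1 ≤ i j := by
        by_contra! h
        have : ∑ j ∈ s, i j ≤ s.card • (r + 1) :=
          Finset.sum_le_card_nsmul s i (r + 1) fun j hj => (h j hj).le
        rw [smul_eq_mul] at this
        omega
      have hcj : c j ∈ (⊥ : Subgroup G) := hD ▸ derivedSeries_antitone G hij (hc j)
      rw [Subgroup.mem_bot.1 (hw.lift_mem inferInstance hj hcj)]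
      exact N.one_mem
    | succ k ih =>
      intro i hi c hc
      have hdeep : ∀ j ∈ s, ∀ c : ℕ → G, (∀ l, c l ∈ derivedSeries G (i l)) →
          c j ∈ derivedSeries G (i j + 1) → FreeGroup.lift c w ∈ N := by
        intro j hj c hc hcj
        refine ih (Function.update i j (i j + 1)) ?_ c fun l => ?_
        · rw [Finset.sum_update_of_mem hj, ← Finset.erase_eq]
          have := Finset.add_sum_erase s i hj
          omega
        · by_cases h : l = j
          · subst h; simpa using hcj
          · simpa [h] using hc l
      -- In the position `m` of the deepest entry the word is linear modulo `N`: the entries in the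
      -- other positions are conjugated by elements of `derivedSeries G (i m)`, and as `i j ≤ i m`,
      -- this changes them only by elements of `derivedSeries G (i j + 1)`.
      obtain ⟨m, hm, hmax⟩ := s.exists_max_image i hw.nonempty
      have hlin : ∀ g ∈ derivedSeries G (i m), ∀ g' ∈ derivedSeries G (i m),
          (FreeGroup.lift (Function.update c m g') w)⁻¹ *
            ((FreeGroup.lift (Function.update c m g) w)⁻¹ *
              FreeGroup.lift (Function.update c m (g * g')) w) ∈ N := by
        intro g hg g' hg'
        obtain ⟨d, e, hd, hem, hej, he⟩ := hw.exists_inv_mul_eq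
          (derivedSeries_normal G (i m)) hm (c := Function.update c m g)
          (c' := Function.update c m (g * g')) (fun j hj => by simp [hj]) (by simpa using hg)
        rw [he]
        have hcD : ∀ j, Function.update c m g' j ∈ derivedSeries G (i j) := fun j => by
          by_cases h : j = m
          · subst h; simpa using hg'
          · simpa [h] using hc j
        have hej' : ∀ j, e j = (d j)⁻¹ * Function.update c m g' j * d j := fun j => by
          by_cases h : j = m
          · subst h; simpa using hem
          · simpa [h] using hej j h
        refine hw.inv_mul_mem_of_forall (D := fun j => derivedSeries G (i j))
          (E := fun j => derivedSeries G (i j + 1)) (fun _ => inferInstance)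
          (fun _ => inferInstance) hdeep hcD (fun j => ?_) (fun j hj => ?_)
        · rw [hej']
          simpa using (derivedSeries_normal G (i j)).conj_mem _ (hcD j) (d j)⁻¹
        · have h := Subgroup.commutator_mem_commutator ((derivedSeries G (i j)).inv_mem (hcD j))
            ((derivedSeries G (i j)).inv_mem (derivedSeries_antitone G (hmax j hj) (hd j)))
          rw [← derivedSeries_succ] at h
          simpa [hej', commutatorElement_def, mul_assoc] using h
      have hpow : ∀ n : ℕ, (FreeGroup.lift c w ^ n)⁻¹ *
          FreeGroup.lift (Function.update c m (c m ^ n)) w ∈ N := by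
        intro n
        induction n with
        | zero =>
          rw [hL m hm (Function.update c m (c m ^ 0)) (by simp)]
          simp
        | succ n ihn =>
          have h := hlin (c m ^ n) (Subgroup.pow_mem _ (hc m) n) (c m) (hc m)
          rw [Function.update_eq_self, ← pow_succ] at h
          have h2 := hNn.conj_mem _ ihn (FreeGroup.lift c w)⁻¹
          simpa [mul_assoc, pow_succ] using N.mul_mem h2 h
      have h1 := hpow L.index
      rw [hL m hm (Function.update c m (c m ^ L.index))
        (by simpa using L.pow_index_mem (c m)), mul_one] at h1
      refine ⟨Subgroup.subset_closure ⟨c, rfl⟩, ?_⟩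
      have h2 := (N.inv_mem h1).2
      rw [inv_inv] at h2
      exact h2.of_pow Subgroup.FiniteIndex.index_ne_zero
  exact (key _ (fun _ => 0) (Nat.le_add_right _ _) c fun j => by simp).2

theorem finite_closure_of_commute {S : Set G} (hS : S.Finite)
    (hcomm : ∀ x ∈ Subgroup.closure S, ∀ y ∈ Subgroup.closure S, Commute x y)
    (hfin : ∀ x ∈ S, IsOfFinOrder x) : Finite (Subgroup.closure S) := by
  let _ : CommGroup (Subgroup.closure S) :=
    { (inferInstance : Group (Subgroup.closure S)) with
      mul_comm := fun x y => Subtype.ext (hcomm x x.2 y y.2) }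
  have : Group.FG (Subgroup.closure S) :=
    (Group.fg_iff_subgroup_fg _).2 ((Subgroup.fg_iff _).2 ⟨S, rfl, hS⟩)
  refine CommGroup.finite_of_fg_isMulTorsion _ fun x => ?_
  rw [← Submonoid.isOfFinOrder_coe]
  obtain ⟨x, hx⟩ := x
  change IsOfFinOrder x
  induction hx using Subgroup.closure_induction with
  | mem x hx => exact hfin x hx
  | one => exact IsOfFinOrder.one
  | mul x y hx hy h1 h2 => exact (hcomm x hx y hy).isOfFinOrder_mul h1 h2
  | inv x _ h => exact h.inv

/-- Schur's theorem: a group with centre of finite index has finite commutator subgroup. -/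
theorem finite_commutator_of_finiteIndex_center [(Subgroup.center G).FiniteIndex] :
    Finite (commutator G) := by
  have : Finite (commutatorSet G) := by
    let f : (G ⧸ Subgroup.center G) × (G ⧸ Subgroup.center G) → G := fun p =>
      ⁅p.1.out, p.2.out⁆
    refine ((Set.finite_range f).subset ?_).to_subtype
    rintro _ ⟨x, y, rfl⟩
    refine ⟨(x, y), ?_⟩
    obtain ⟨⟨a, ha⟩, hx⟩ := QuotientGroup.mk_out_eq_mul (Subgroup.center G) x
    obtain ⟨⟨b, hb⟩, hy⟩ := QuotientGroup.mk_out_eq_mul (Subgroup.center G) y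
    have ha' := Subgroup.mem_center_iff.1 ha
    have hb' := Subgroup.mem_center_iff.1 hb
    change ⁅(x : G ⧸ Subgroup.center G).out, (y : G ⧸ Subgroup.center G).out⁆ = _
    rw [hx, hy]
    change (x * a) * (y * b) * (x * a)⁻¹ * (y * b)⁻¹ = x * y * x⁻¹ * y⁻¹
    calc (x * a) * (y * b) * (x * a)⁻¹ * (y * b)⁻¹
        = x * (a * (y * b)) * a⁻¹ * x⁻¹ * b⁻¹ * y⁻¹ := by group
      _ = x * y * (b * x⁻¹) * b⁻¹ * y⁻¹ := by rw [← ha' (y * b)]; group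
      _ = x * y * x⁻¹ * y⁻¹ := by rw [← hb' x⁻¹]; group
  infer_instance

/-- If a multilinear commutator takes the value `1` as soon as one entry lies in a normal subgroup
`L` of finite index, then the subgroup generated by its values is finite. -/
theorem IsMultilinearCommutatorIn.finite_closure_wordValues
    (hw : IsMultilinearCommutatorIn s w) {G : Type u} [Group G] {L : Subgroup G} (hLn : L.Normal)
    [L.FiniteIndex] (hL : ∀ k ∈ s, ∀ c : ℕ → G, c k ∈ L → FreeGroup.lift c w = 1) :
    Finite (Subgroup.closure (wordValues w G)) := by
  set W := Subgroup.closure (wordValues w G) with hW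
  have hWn : W.Normal := closure_wordValues_normal w G
  -- Conjugation by an element of `L` changes the entries of a value only modulo `L`.
  have hLW : L ≤ Subgroup.centralizer (W : Set G) := by
    rw [hW, Subgroup.centralizer_closure]
    intro l hl
    rw [Subgroup.mem_centralizer_iff]
    rintro _ ⟨c, rfl⟩
    have h := hw.inv_mul_mem_of_forall (D := fun _ => ⊤) (E := fun _ => L) (T := ⊥)
      (c := c) (c' := fun j => l⁻¹ * c j * l) (fun _ => inferInstance) (fun _ => hLn)
      (fun j hj c _ hc => Subgroup.mem_bot.2 (hL j hj c hc)) (fun _ => trivial) (fun _ => trivial)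
      (fun j _ => by
        simpa [mul_assoc] using L.mul_mem (hLn.conj_mem _ (L.inv_mem hl) (c j)⁻¹) hl)
    rw [lift_conj, Subgroup.mem_bot, inv_mul_eq_one] at h
    rw [eq_comm, ← eq_inv_mul_iff_mul_eq, ← mul_assoc]
    exact h
  have hcenter : L.subgroupOf W ≤ Subgroup.center W := fun x hx =>
    Subgroup.mem_center_iff.2 fun y => Subtype.ext <|
      Subgroup.mem_centralizer_iff.1 (hLW hx) y y.2
  have : (Subgroup.center W).FiniteIndex := Subgroup.finiteIndex_of_le hcenter
  have hfin : Finite (commutator W) := finite_commutator_of_finiteIndex_center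
  have hA : Finite ((⁅W, W⁆ : Subgroup G)) := by
    rw [← Subgroup.map_subtype_commutator]
    exact Finite.of_surjective _ (W.subtype.subgroupMap_surjective (commutator W))
  set A : Subgroup G := ⁅W, W⁆ with hAdef
  let π := QuotientGroup.mk' A
  have hπ : Function.Surjective π := QuotientGroup.mk'_surjective A
  have hLπ : (L.map π).FiniteIndex := finiteIndex_map hπ L
  have hLπ1 : ∀ k ∈ s, ∀ c : ℕ → G ⧸ A, c k ∈ L.map π → FreeGroup.lift c w = 1 := by
    intro k hk c hc
    obtain ⟨c, hck, rfl⟩ := exists_lift_tuple hπ hc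
    rw [← map_lift_apply, hL k hk c hck, map_one]
  have hcomm : ∀ x ∈ Subgroup.closure (wordValues w (G ⧸ A)),
      ∀ y ∈ Subgroup.closure (wordValues w (G ⧸ A)), Commute x y := by
    rw [← map_closure_wordValues π hπ]
    rintro _ ⟨x, hx, rfl⟩ _ ⟨y, hy, rfl⟩
    rw [← commutatorElement_eq_one_iff_commute, ← map_commutatorElement]
    exact (QuotientGroup.eq_one_iff _).2 (Subgroup.commutator_mem_commutator hx hy)
  have hLn' : (L.map π).Normal := hLn.map π hπ
  have hfinQ : Finite (Subgroup.closure (wordValues w (G ⧸ A))) :=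
    finite_closure_of_commute (hw.finite_wordValues hLn' hLπ1) hcomm (by
      rintro _ ⟨c, rfl⟩
      exact hw.isOfFinOrder_of_commute hLn' hLπ1 hcomm c)
  rw [← map_closure_wordValues π hπ, ← hW] at hfinQ
  refine Set.finite_coe_iff.2 (Set.Finite.of_finite_fibers (f := π)
    (s := (W : Set G)) ?_ fun q _ => ?_)
  · exact Set.toFinite (W.map π : Set (G ⧸ A))
  · obtain ⟨g, rfl⟩ := hπ q
    refine ((Set.toFinite (A : Set G)).image (g * ·)).subset ?_
    rintro x ⟨-, hx⟩
    exact ⟨g⁻¹ * x, QuotientGroup.eq.1 (Eq.symm hx), by simp⟩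

end Marginal

/-! ### Closed subgroups belonging to the class -/

section ClosedSpan

variable {G : Type*} [Group G] [TopologicalSpace G] [IsTopologicalGroup G]

/-- The smallest closed subgroup containing `X`; `verbalSubgroup w G` is by definition
`closedSpan (wordValues w G)`. -/
def closedSpan (X : Set G) :
    Subgroup G :=
  (Subgroup.closure X).topologicalClosure

theorem isClosed_closedSpan (X : Set G) : IsClosed (closedSpan X : Set G) :=
  Subgroup.isClosed_topologicalClosure _

theorem subset_closedSpan (X : Set G) : X ⊆ closedSpan X :=
  Subgroup.subset_closure.trans (Subgroup.le_topologicalClosure _)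

theorem closedSpan_le {X : Set G} {A : Subgroup G} (hA : IsClosed (A : Set G)) (h : X ⊆ A) :
    closedSpan X ≤ A :=
  Subgroup.topologicalClosure_minimal _ ((Subgroup.closure_le A).2 h) hA

theorem closedSpan_conj_mem {X : Set G} {b : G} (h : ∀ x ∈ X, b * x * b⁻¹ ∈ X) {x : G}
    (hx : x ∈ closedSpan X) : b * x * b⁻¹ ∈ closedSpan X := by
  have hle : closedSpan X ≤ (closedSpan X).comap (MulAut.conj b).toMonoidHom := by
    refine closedSpan_le ?_ fun x hx => subset_closedSpan X (h x hx)
    exact (isClosed_closedSpan X).preimage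
      (show Continuous fun x : G => b * x * b⁻¹ by fun_prop)
  exact hle hx

end ClosedSpan

section Classes

variable {C : GroupClass.{u}}
variable {G : Type u} [Group G] [TopologicalSpace G] [IsTopologicalGroup G] [CompactSpace G]
  [TotallyDisconnectedSpace G]

/-- Membership in the class is invariant under continuous embeddings into profinite groups. -/
theorem GroupClass.IsAdmissible.map_iff (hC : C.IsAdmissible) {G' : Type u}
    [Group G'] [TopologicalSpace G'] [IsTopologicalGroup G'] [CompactSpace G']
    [TotallyDisconnectedSpace G'] (f : G →* G')
    (hf : Continuous f) (hinj : Function.Injective f) {K : Subgroup G}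
    (hK : IsClosed (K : Set G)) : C K ↔ C (K.map f) := by
  have hKc : CompactSpace K := isCompact_iff_compactSpace.1 hK.isCompact
  have hK' : CompactSpace (K.map f) :=
    isCompact_iff_compactSpace.1 (hK.isCompact.image hf)
  let e := K.equivMapOfInjective f hinj
  have he : Continuous e := (hf.comp continuous_subtype_val).subtype_mk _
  let e' : K ≃ₜ* K.map f :=
    { e with
      continuous_toFun := he
      continuous_invFun :=
        (Continuous.homeoOfEquivCompactToT2 (f := e.toEquiv) he).symm.continuous }
  exact ⟨hC.iso _ _ e', hC.iso _ _ e'.symm⟩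

theorem GroupClass.IsAdmissible.subgroupOf_iff (hC : C.IsAdmissible)
    {A B : Subgroup G} (hB : IsClosed (B : Set G))
    (hA : IsClosed (A : Set G)) (h : A ≤ B) : C (A.subgroupOf B) ↔ C A := by
  have : CompactSpace B := isCompact_iff_compactSpace.1 hB.isCompact
  rw [hC.map_iff B.subtype continuous_subtype_val B.subtype_injective
    (K := A.subgroupOf B) (hA.preimage continuous_subtype_val), Subgroup.map_subgroupOf_eq_of_le h]

theorem GroupClass.IsAdmissible.of_le (hC : C.IsAdmissible)
    {A K : Subgroup G} (hK : IsClosed (K : Set G)) (hCK : C K)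
    (hA : IsClosed (A : Set G)) (h : A ≤ K) : C A := by
  have : CompactSpace K := isCompact_iff_compactSpace.1 hK.isCompact
  exact (hC.subgroupOf_iff hK hA h).1
    (hC.subgroup K (A.subgroupOf K) (hA.preimage continuous_subtype_val) hCK)

/-- `S` is a closed `C`-subgroup of `G`, contained in the subgroup `B` and normalized by it. -/
structure GroupClass.NormalIn (C : GroupClass.{u}) {G : Type u} [Group G] [TopologicalSpace G]
    (B S : Subgroup G) : Prop where
  le : S ≤ B
  isClosed : IsClosed (S : Set G)
  mem : C S
  conj_mem : ∀ b ∈ B, ∀ x ∈ S, b * x * b⁻¹ ∈ S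

theorem GroupClass.IsAdmissible.normalIn_sup (hC : C.IsAdmissible)
    {B M N : Subgroup G} (hB : IsClosed (B : Set G))
    (hM : C.NormalIn B M) (hN : C.NormalIn B N) : C.NormalIn B (M ⊔ N) := by
  have hBc : CompactSpace B := isCompact_iff_compactSpace.1 hB.isCompact
  have hM' : (M.subgroupOf B).Normal := ⟨fun x hx b => hM.conj_mem b b.2 x hx⟩
  have hN' : (N.subgroupOf B).Normal := ⟨fun x hx b => hN.conj_mem b b.2 x hx⟩
  have hMc : IsClosed (M.subgroupOf B : Set B) := hM.isClosed.preimage continuous_subtype_val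
  have hNc : IsClosed (N.subgroupOf B : Set B) := hN.isClosed.preimage continuous_subtype_val
  have hmap : (M.subgroupOf B ⊔ N.subgroupOf B).map B.subtype = M ⊔ N := by
    rw [Subgroup.map_sup, Subgroup.map_subgroupOf_eq_of_le hM.le,
      Subgroup.map_subgroupOf_eq_of_le hN.le]
  have hcpt : IsCompact ((M.subgroupOf B ⊔ N.subgroupOf B : Subgroup B) : Set B) := by
    rw [Subgroup.mul_normal]
    exact hMc.isCompact.mul hNc.isCompact
  have hprod := hC.product B _ _ hM' hN' hMc hNc ((hC.subgroupOf_iff hB hM.isClosed hM.le).2 hM.mem)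
    ((hC.subgroupOf_iff hB hN.isClosed hN.le).2 hN.mem)
  rw [hC.map_iff B.subtype continuous_subtype_val B.subtype_injective hcpt.isClosed, hmap] at hprod
  refine ⟨sup_le hM.le hN.le, ?_, hprod, ?_⟩
  · rw [← hmap]
    exact (hcpt.image continuous_subtype_val).isClosed
  · rw [← hmap]
    rintro b hb _ ⟨x, hx, rfl⟩
    exact ⟨⟨b, hb⟩ * x * ⟨b, hb⟩⁻¹, (Subgroup.sup_normal _ _).conj_mem x hx ⟨b, hb⟩, rfl⟩

theorem GroupClass.IsAdmissible.normalIn_finset_sup (hC : C.IsAdmissible)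
    {ι : Type*} {B : Subgroup G}
    (hB : IsClosed (B : Set G)) (hbot : C (⊥ : Subgroup G)) (F : Finset ι) (S : ι → Subgroup G)
    (hS : ∀ i ∈ F, C.NormalIn B (S i)) : C.NormalIn B (F.sup S) := by
  refine Finset.sup_induction ⟨bot_le, isClosed_singleton, hbot, fun b _ x hx => ?_⟩
    (fun M hM N hN => hC.normalIn_sup hB hM hN) hS
  rw [Subgroup.mem_bot] at hx
  simp [hx]

theorem open_normal_finset_inf {G : Type*} [Group G] [TopologicalSpace G] {ι : Type*}
    (F : Finset ι) (S : ι → Subgroup G)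
    (hS : ∀ i ∈ F, (S i).Normal ∧ IsOpen (S i : Set G)) :
    (F.inf S).Normal ∧ IsOpen ((F.inf S : Subgroup G) : Set G) :=
  Finset.inf_induction (p := fun S : Subgroup G => S.Normal ∧ IsOpen (S : Set G))
    ⟨inferInstance, isOpen_univ⟩
    (fun M hM N hN => ⟨by have := hM.1; have := hN.1; infer_instance, hM.2.inter hN.2⟩) hS

end Classes

/-! ### Values in a coset of a subgroup of the class -/

section Cosets

variable {C : GroupClass.{u}}
variable {G : Type u} [Group G] [TopologicalSpace G] [IsTopologicalGroup G] [CompactSpace G]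
  [TotallyDisconnectedSpace G] {s : Finset ℕ} {w : FreeGroup ℕ}

theorem IsMultilinearCommutatorIn.continuous_lift {G : Type*} [Group G] [TopologicalSpace G]
    [IsTopologicalGroup G] (hw : IsMultilinearCommutatorIn s w) :
    Continuous fun c : ℕ → G => FreeGroup.lift c w := by
  induction hw with
  | var i => simpa using continuous_apply i
  | comm hu hv hst ihu ihv =>
    simp only [lift_commutatorWord]
    fun_prop

/-- By Baire's theorem, if the `w`-values are covered by countably many cosets of closed
`C`-subgroups, then every coset of an open subgroup in the space of tuples contains a smaller
one on which `w` takes values in a single coset. -/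
theorem IsMultilinearCommutatorIn.exists_coset (hw : IsMultilinearCommutatorIn s w)
    (hcov : C.CountablyCovers (wordValues w G)) {H : Subgroup G} (hH : IsOpen (H : Set G))
    (a : ℕ → G) :
    ∃ (L : Subgroup G) (c₀ : ℕ → G) (g : G) (K : Subgroup G), L.Normal ∧ IsOpen (L : Set G) ∧
      (∀ j ∈ s, (a j)⁻¹ * c₀ j ∈ H) ∧ IsClosed (K : Set G) ∧ C K ∧
      ∀ c : ℕ → G, (∀ j, (c₀ j)⁻¹ * c j ∈ L) → FreeGroup.lift c w ∈ g • (K : Set G) := by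
  obtain ⟨g, K, hKc, hCK, hsub⟩ := hcov
  have hdense := dense_iUnion_interior_of_closed
    (f := fun i => (fun c : ℕ → G => FreeGroup.lift c w) ⁻¹' (g i • (K i : Set G)))
    (fun i => ((hKc i).leftCoset (g i)).preimage hw.continuous_lift) (by
      refine Set.eq_univ_of_forall fun c => ?_
      obtain ⟨i, hi⟩ := Set.mem_iUnion.1 (hsub ⟨c, rfl⟩)
      exact Set.mem_iUnion.2 ⟨i, hi⟩)
  have hU : IsOpen {c : ℕ → G | ∀ j ∈ s, (a j)⁻¹ * c j ∈ H} := by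
    have : {c : ℕ → G | ∀ j ∈ s, (a j)⁻¹ * c j ∈ H} =
        ⋂ j ∈ s, (fun c : ℕ → G => (a j)⁻¹ * c j) ⁻¹' (H : Set G) := by
      ext c; simp
    rw [this]
    exact isOpen_biInter_finset fun j _ => hH.preimage (by fun_prop)
  obtain ⟨c₀, hc₀, hc₀'⟩ := hdense.inter_open_nonempty _ hU ⟨a, fun j _ => by simp [H.one_mem]⟩
  obtain ⟨i, hi⟩ := Set.mem_iUnion.1 hc₀'
  obtain ⟨J, v, hv, hJ⟩ := isOpen_pi_iff.1 isOpen_interior c₀ hi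
  have hex : ∀ j : ℕ, ∃ N : Subgroup G, N.Normal ∧ IsOpen (N : Set G) ∧
      (j ∈ J → ∀ x ∈ N, c₀ j * x ∈ v j) := by
    intro j
    by_cases hj : j ∈ J
    · obtain ⟨N, hN⟩ := ProfiniteGrp.exist_openNormalSubgroup_sub_open_nhds_of_one
        (U := (fun x => c₀ j * x) ⁻¹' v j) ((hv j hj).1.preimage (by fun_prop))
        (by simpa using (hv j hj).2)
      exact ⟨N.toSubgroup, N.isNormal', N.isOpen', fun _ x hx => hN hx⟩
    · exact ⟨⊤, inferInstance, isOpen_univ, fun h => absurd h hj⟩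
  choose N hNn hNo hN using hex
  obtain ⟨hLn, hLo⟩ := open_normal_finset_inf J N fun j _ => ⟨hNn j, hNo j⟩
  refine ⟨J.inf N, c₀, g i, K i, hLn, hLo, hc₀, hKc i, hCK i, fun c hc => ?_⟩
  have h := hJ (a := c) fun j hj => ?_
  · have h' := interior_subset h
    exact h'
  · simpa using hN j hj _ (Finset.inf_le (f := N) hj (hc j))

/-- If `w` takes values in a coset of a closed `C`-subgroup on a coset of `L` in the space of
tuples, then one can replace the entry in position `k` of the representative by `1`, and `w` then
takes values in a conjugate of that subgroup. -/
theorem IsMultilinearCommutatorIn.exists_remove_one (hw : IsMultilinearCommutatorIn s w)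
    (hC : C.IsAdmissible)
    {L H : Subgroup G} (hL : L.Normal) (hH : H.Normal) {k : ℕ} (hk : k ∈ s) {a : ℕ → G}
    (ha : a k ∈ H) {g : G} {K : Subgroup G} (hK : IsClosed (K : Set G)) (hCK : C K)
    (hval : ∀ c : ℕ → G, (∀ j, (c j : G ⧸ L) = a j) → FreeGroup.lift c w ∈ g • (K : Set G)) :
    ∃ (b : ℕ → G) (K' : Subgroup G), IsClosed (K' : Set G) ∧ C K' ∧ b k = 1 ∧
      (∀ j, a j = 1 → b j = 1) ∧ (∀ j, (a j)⁻¹ * b j ∈ H) ∧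
      ∀ c : ℕ → G, (∀ j, (c j : G ⧸ L) = b j) → FreeGroup.lift c w ∈ K' := by
  classical
  have hπ := QuotientGroup.mk'_surjective L
  obtain ⟨a', d, e, he, hd, hk1, haj, hq⟩ := hw.exists_coset_tuple (QuotientGroup.mk' L) hπ
    (hH.map _ hπ) hk (fun j => QuotientGroup.mk' L (a j)) (Subgroup.mem_map_of_mem _ ha)
  choose δ hδH hδ using hd
  obtain ⟨ε, -, hε⟩ := he
  have hcont : Continuous (MulAut.conj ε).toMonoidHom :=
    show Continuous fun x : G => ε * x * ε⁻¹ by fun_prop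
  refine ⟨fun j => if j = k then 1 else (δ j)⁻¹ * a j * δ j,
    K.map (MulAut.conj ε).toMonoidHom, (hK.isCompact.image hcont).isClosed,
    (hC.map_iff _ hcont (MulAut.conj ε).injective hK).1 hCK, by simp, fun j hj => by simp [hj],
    fun j => ?_, fun c hc => ?_⟩
  · by_cases h : j = k
    · subst h; simpa using ha
    · simpa [h, mul_assoc] using H.mul_mem (hH.conj_mem _ (H.inv_mem (hδH j)) (a j)⁻¹) (hδH j)
  · obtain ⟨c₁, c₂, γ, hc₁, hc₂, hγ, h⟩ := hq c fun j => by
      refine (hc j).trans ?_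
      by_cases h : j = k
      · subst h; simp [hk1]
      · rw [haj j h, ← hδ j]; simp [h]
    -- Conjugating by an element of `L`, one may assume that `γ = ε`.
    have hl : QuotientGroup.mk' L (γ⁻¹ * ε) = 1 := by
      rw [map_mul, map_inv, hγ, hε, inv_mul_cancel]
    have hconj : ∀ c₁ : ℕ → G, (∀ j, QuotientGroup.mk' L (c₁ j) = QuotientGroup.mk' L (a j)) →
        (γ⁻¹ * ε)⁻¹ * FreeGroup.lift c₁ w * (γ⁻¹ * ε) ∈ g • (K : Set G) := by
      intro c₁ hc₁
      rw [← lift_conj]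
      refine hval _ fun j => ?_
      change QuotientGroup.mk' L _ = QuotientGroup.mk' L (a j)
      rw [map_mul, map_mul, map_inv, hl, hc₁]
      simp
    have h1 := Set.mem_smul_set_iff_inv_smul_mem.1 (hconj c₁ hc₁)
    have h2 := Set.mem_smul_set_iff_inv_smul_mem.1 (hconj c₂ hc₂)
    have h3 := K.mul_mem (K.inv_mem h1) h2
    refine ⟨_, h3, ?_⟩
    have h4 : FreeGroup.lift c w =
        γ * ((FreeGroup.lift c₁ w)⁻¹ * FreeGroup.lift c₂ w) * γ⁻¹ := by rw [h]; group
    rw [h4]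
    simp only [MulEquiv.toMonoidHom_eq_coe, MonoidHom.coe_coe, MulAut.conj_apply, smul_eq_mul]
    group

/-- Replacing by `1` all the entries of the representative in the positions of a nonempty set
`I`. -/
theorem IsMultilinearCommutatorIn.exists_remove (hw : IsMultilinearCommutatorIn s w)
    (hC : C.IsAdmissible)
    {L H : Subgroup G} (hL : L.Normal) (hH : H.Normal) {I : Finset ℕ} (hI : I ⊆ s)
    (hIne : I.Nonempty) {a : ℕ → G}
    (ha : ∀ i ∈ I, a i ∈ H) {g : G} {K : Subgroup G} (hK : IsClosed (K : Set G)) (hCK : C K)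
    (hval : ∀ c : ℕ → G, (∀ j, (c j : G ⧸ L) = a j) → FreeGroup.lift c w ∈ g • (K : Set G)) :
    ∃ (b : ℕ → G) (K' : Subgroup G), IsClosed (K' : Set G) ∧ C K' ∧ (∀ i ∈ I, b i = 1) ∧
      (∀ j, (a j)⁻¹ * b j ∈ H) ∧
      ∀ c : ℕ → G, (∀ j, (c j : G ⧸ L) = b j) → FreeGroup.lift c w ∈ K' := by
  classical
  have key : ∀ F : Finset ℕ, F ⊆ I → ∃ (b : ℕ → G) (g : G) (K' : Subgroup G),
      IsClosed (K' : Set G) ∧ C K' ∧ (∀ i ∈ F, b i = 1) ∧ (∀ j, (a j)⁻¹ * b j ∈ H) ∧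
      ∀ c : ℕ → G, (∀ j, (c j : G ⧸ L) = b j) → FreeGroup.lift c w ∈ g • (K' : Set G) := by
    intro F
    induction F using Finset.induction_on with
    | empty =>
      intro _
      exact ⟨a, g, K, hK, hCK, by simp, fun j => by simp [H.one_mem], hval⟩
    | insert k F hkF ih =>
      intro hF
      obtain ⟨b, g', K', hK', hCK', hb1, hbH, hbv⟩ :=
        ih fun j hj => hF (Finset.mem_insert_of_mem hj)
      have hkI := hF (Finset.mem_insert_self k F)
      obtain ⟨b', K'', hK'', hCK'', hk1, h1, hbH', hbv'⟩ :=
        hw.exists_remove_one hC hL hH (hI hkI)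
          (by simpa using H.mul_mem (ha k hkI) (hbH k)) hK' hCK' hbv
      refine ⟨b', 1, K'', hK'', hCK'', fun i hi => ?_, fun j => ?_, fun c hc => ?_⟩
      · rcases Finset.mem_insert.1 hi with rfl | hi
        · exact hk1
        · exact h1 i (hb1 i hi)
      · simpa [mul_assoc] using H.mul_mem (hbH j) (hbH' j)
      · simpa using hbv' c hc
  obtain ⟨b, g', K', hK', hCK', hb1, hbH, hbv⟩ := key I subset_rfl
  obtain ⟨k, hkI⟩ := hIne
  obtain ⟨b', K'', hK'', hCK'', -, h1, hbH', hbv'⟩ :=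
    hw.exists_remove_one hC hL hH (hI hkI) (by rw [hb1 k hkI]; exact H.one_mem) hK' hCK' hbv
  exact ⟨b', K'', hK'', hCK'', fun i hi => h1 i (hb1 i hi),
    fun j => by simpa [mul_assoc] using H.mul_mem (hbH j) (hbH' j), hbv'⟩

end Cosets

/-! ### Verbal subgroups with some entries in an open normal subgroup -/

/-- The `w`-values whose entries in the positions belonging to `I` lie in `L`. -/
def restrictedValues {G : Type*} [Group G] (w : FreeGroup ℕ) (I : Finset ℕ) (L : Subgroup G) :
    Set G :=
  {x | ∃ c : ℕ → G, (∀ i ∈ I, c i ∈ L) ∧ FreeGroup.lift c w = x}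

theorem restrictedValues_mono {G : Type*} [Group G] (w : FreeGroup ℕ) (I : Finset ℕ)
    {L L' : Subgroup G} (h : L ≤ L') : restrictedValues w I L ⊆ restrictedValues w I L' := by
  rintro _ ⟨c, hc, rfl⟩
  exact ⟨c, fun i hi => h (hc i hi), rfl⟩

theorem restrictedValues_conj_mem {G : Type*} [Group G] {w : FreeGroup ℕ} {I : Finset ℕ}
    {L : Subgroup G} (hL : L.Normal) (g : G) :
    ∀ x ∈ restrictedValues w I L, g * x * g⁻¹ ∈ restrictedValues w I L := by
  rintro _ ⟨c, hc, rfl⟩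
  refine ⟨fun j => (g⁻¹)⁻¹ * c j * g⁻¹, fun i hi => ?_, by rw [lift_conj, inv_inv]⟩
  simpa using hL.conj_mem _ (hc i hi) g

theorem normalIn_top_closedSpan {C : GroupClass.{u}} {G : Type u} [Group G] [TopologicalSpace G]
    [IsTopologicalGroup G] {w : FreeGroup ℕ} {I : Finset ℕ} {L : Subgroup G} (hL : L.Normal)
    (h : C (closedSpan (restrictedValues w I L))) :
    C.NormalIn ⊤ (closedSpan (restrictedValues w I L)) :=
  ⟨le_top, isClosed_closedSpan _, h,
    fun b _ _ hx => closedSpan_conj_mem (restrictedValues_conj_mem hL b) hx⟩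

section Main

variable {C : GroupClass.{u}} {G : Type u} [Group G] [TopologicalSpace G] [IsTopologicalGroup G]
  [CompactSpace G] [TotallyDisconnectedSpace G] {s : Finset ℕ} {w : FreeGroup ℕ}

theorem GroupClass.IsAdmissible.bot_mem (hC : C.IsAdmissible) {S : Set G}
    (hcov : C.CountablyCovers S) : C (⊥ : Subgroup G) := by
  obtain ⟨-, K, hK, hCK, -⟩ := hcov
  exact hC.of_le (hK 0) (hCK 0) isClosed_singleton bot_le

/-- If the `w`-values are covered by countably many cosets of closed `C`-subgroups, then for every
nonempty set `I` of positions there is an open normal subgroup `L` such that the `w`-values with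
entries in `L` in these positions generate a `C`-subgroup.  The proof is by induction on the number
of positions outside `I`.  Baire's theorem is used in each of the finitely many cosets of the
subgroup provided by the inductive hypothesis, and the values in the smaller cosets generate
`C`-subgroups which are normal in `L`; the other values are congruent to these modulo the
`C`-subgroups coming from larger sets of positions. -/
theorem IsMultilinearCommutatorIn.exists_open_normal (hw : IsMultilinearCommutatorIn s w)
    (hC : C.IsAdmissible) (hcov : C.CountablyCovers (wordValues w G)) (n : ℕ) :
    ∀ I : Finset ℕ, I ⊆ s → I.Nonempty → (s \ I).card = n →
      ∃ L : Subgroup G, L.Normal ∧ IsOpen (L : Set G) ∧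
        C (closedSpan (restrictedValues w I L)) := by
  classical
  induction n using Nat.strong_induction_on with
  | _ n ih =>
  intro I hI hIne hn
  have hbot := hC.bot_mem hcov
  -- The inductive hypothesis, for the sets of positions `insert j I`.
  have hex : ∀ j, ∃ N : Subgroup G, N.Normal ∧ IsOpen (N : Set G) ∧
      (j ∈ s \ I → C (closedSpan (restrictedValues w (insert j I) N))) := by
    intro j
    by_cases hj : j ∈ s \ I
    · obtain ⟨hjs, hjI⟩ := Finset.mem_sdiff.1 hj
      obtain ⟨N, h1, h2, h3⟩ := ih (s \ insert j I).card
        (hn ▸ Finset.card_lt_card (by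
          rw [Finset.ssubset_iff_of_subset (Finset.sdiff_subset_sdiff subset_rfl
            (Finset.subset_insert j I))]
          exact ⟨j, hj, by simp⟩)) (insert j I)
        (Finset.insert_subset hjs hI) (Finset.insert_nonempty _ _) rfl
      exact ⟨N, h1, h2, fun _ => h3⟩
    · exact ⟨⊤, inferInstance, isOpen_univ, fun h => absurd h hj⟩
  choose N hNn hNo hNC using hex
  obtain ⟨hHn, hHo⟩ := open_normal_finset_inf (s \ I) N fun j _ => ⟨hNn j, hNo j⟩
  set H := (s \ I).inf N
  set T : Subgroup G := (s \ I).sup fun j => closedSpan (restrictedValues w (insert j I) H)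
  have hT : C.NormalIn ⊤ T := by
    refine hC.normalIn_finset_sup isClosed_univ hbot _ _ fun j hj => ?_
    refine normalIn_top_closedSpan hHn (hC.of_le (isClosed_closedSpan _) (hNC j hj)
      (isClosed_closedSpan _) (closedSpan_le (isClosed_closedSpan _) ?_))
    exact (restrictedValues_mono w _ (Finset.inf_le hj)).trans (subset_closedSpan _)
  -- Baire's theorem in each coset of `H`, the representatives being `1` in the positions of `I`.
  have hfinH : Finite (G ⧸ H) := Subgroup.quotient_finite_of_isOpen H hHo
  have := Fintype.ofFinite (s → G ⧸ H)
  choose L₀ c₀ g K hL₀n hL₀o hc₀ hKc hCK hval using fun τ : s → G ⧸ H =>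
    hw.exists_coset hcov hHo
      (fun j => if h : j ∈ s ∧ j ∉ I then (τ ⟨j, h.1⟩).out else 1)
  obtain ⟨hL₁n, hL₁o⟩ := open_normal_finset_inf Finset.univ L₀ fun τ _ => ⟨hL₀n τ, hL₀o τ⟩
  set L := Finset.univ.inf L₀ ⊓ H with hLdef
  have hLn : L.Normal := by rw [hLdef]; infer_instance
  have hLo : IsOpen (L : Set G) := hL₁o.inter hHo
  have hLc : IsClosed (L : Set G) := L.isClosed_of_isOpen hLo
  have hLH : L ≤ H := inf_le_right
  have hc₀H : ∀ τ, ∀ i ∈ I, c₀ τ i ∈ H := fun τ i hi => by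
    simpa [hi] using hc₀ τ i (hI hi)
  choose b K' hK' hCK' hb1 hbH hbv using fun τ => hw.exists_remove hC hLn hHn hI hIne (hc₀H τ)
    (hKc τ) (hCK τ) (fun c hc => hval τ c fun j =>
      Finset.inf_le (f := L₀) (Finset.mem_univ τ) (QuotientGroup.eq.1 (hc j).symm).1)
  have hLmem : ∀ c : ℕ → G, (∀ i ∈ I, c i ∈ L) → FreeGroup.lift c w ∈ L := by
    intro c hc
    obtain ⟨i, hi⟩ := hIne
    exact hw.lift_mem hLn (hI hi) (hc i hi)
  let X : (s → G ⧸ H) → Set G := fun τ =>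
    {x | ∃ c : ℕ → G, (∀ j, (c j : G ⧸ L) = b τ j) ∧ FreeGroup.lift c w = x}
  have hS : ∀ τ ∈ Finset.univ, C.NormalIn L (closedSpan (X τ)) := by
    intro τ _
    refine ⟨closedSpan_le hLc ?_, isClosed_closedSpan _, hC.of_le (hK' τ) (hCK' τ)
      (isClosed_closedSpan _) (closedSpan_le (hK' τ) ?_), fun l hl x hx =>
        closedSpan_conj_mem ?_ hx⟩
    · rintro _ ⟨c, hc, rfl⟩
      refine hLmem c fun i hi => ?_
      rw [← QuotientGroup.eq_one_iff, hc, hb1 τ i hi, QuotientGroup.mk_one]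
    · rintro _ ⟨c, hc, rfl⟩
      exact hbv τ c hc
    · rintro _ ⟨c, hc, rfl⟩
      refine ⟨fun j => (l⁻¹)⁻¹ * c j * l⁻¹, fun j => ?_, by rw [lift_conj, inv_inv]⟩
      rw [← hc j]
      have h1 : (l : G ⧸ L) = 1 := (QuotientGroup.eq_one_iff l).2 hl
      simp [h1]
  have hTL : C.NormalIn L (T ⊓ L) :=
    ⟨inf_le_right, hT.isClosed.inter hLc, hC.of_le hT.isClosed hT.mem (hT.isClosed.inter hLc)
      inf_le_left, fun l hl x hx => ⟨hT.conj_mem l trivial x hx.1, hLn.conj_mem x hx.2 l⟩⟩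
  have hV := hC.normalIn_sup hLc hTL
    (hC.normalIn_finset_sup hLc hbot Finset.univ (fun τ => closedSpan (X τ)) hS)
  refine ⟨L, hLn, hLo, hC.of_le hV.isClosed hV.mem (isClosed_closedSpan _)
    (closedSpan_le hV.isClosed ?_)⟩
  rintro _ ⟨c, hc, rfl⟩
  -- The value at `c` is congruent modulo `T` to a value in the coset chosen inside that of `c`.
  set τ : s → G ⧸ H := fun j => (c j : G ⧸ H)
  set c' : ℕ → G := fun j => if j ∈ I then c j else b τ j with hc'
  have hc'X : FreeGroup.lift c' w ∈ X τ := by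
    refine ⟨c', fun j => ?_, rfl⟩
    by_cases hj : j ∈ I
    · simp only [hc', hj, if_true, hb1 τ j hj]
      exact (QuotientGroup.eq_one_iff _).2 (hc j hj)
    · simp [hc', hj]
  have hc'L : ∀ i ∈ I, c' i ∈ L := fun i hi => by simpa [hc', hi] using hc i hi
  have hmod : (FreeGroup.lift c w)⁻¹ * FreeGroup.lift c' w ∈ T := by
    refine hw.inv_mul_mem_of_forall (D := fun j => if j ∈ I then L else ⊤)
      (E := fun j => if j ∈ I then ⊥ else H) (fun j => ?_) (fun j => ?_)
      (fun j hj e he hej => ?_) (fun j => ?_) (fun j => ?_) (fun j hj => ?_)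
    · split_ifs <;> infer_instance
    · split_ifs <;> infer_instance
    · by_cases hjI : j ∈ I
      · simp only [hjI, if_true] at hej
        rw [Subgroup.mem_bot.1 (hw.lift_mem inferInstance hj hej)]
        exact T.one_mem
      · simp only [hjI, if_false] at hej
        refine Finset.le_sup (f := fun j => closedSpan (restrictedValues w (insert j I) H))
          (Finset.mem_sdiff.2 ⟨hj, hjI⟩) (subset_closedSpan _ ⟨e, fun i hi => ?_, rfl⟩)
        rcases Finset.mem_insert.1 hi with rfl | hi
        · exact hej
        · have := he i
          simp only [hi, if_true] at this
          exact hLH this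
    · by_cases hjI : j ∈ I <;> simp [hjI, hc]
    · by_cases hjI : j ∈ I <;> simp [hjI, hc'L]
    · by_cases hjI : j ∈ I
      · simp [hjI, hc']
      · simp only [hjI, hc', if_false]
        have h1 := hc₀ τ j hj
        simp only [hj, hjI, not_false_eq_true, and_self, dite_true] at h1
        have h2 : (c j)⁻¹ * (τ ⟨j, hj⟩).out ∈ H :=
          QuotientGroup.eq.1 (QuotientGroup.out_eq' (c j : G ⧸ H)).symm
        simpa [mul_assoc] using H.mul_mem (H.mul_mem h2 h1) (hbH τ j)
  have hcL := hLmem c hc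
  have h1 : ((FreeGroup.lift c w)⁻¹ * FreeGroup.lift c' w)⁻¹ ∈ T ⊓ L :=
    (T ⊓ L).inv_mem ⟨hmod, L.mul_mem (L.inv_mem hcL) (hLmem c' hc'L)⟩
  have h2 : FreeGroup.lift c' w ∈ Finset.univ.sup fun τ => closedSpan (X τ) :=
    Finset.le_sup (f := fun τ => closedSpan (X τ)) (Finset.mem_univ τ) (subset_closedSpan _ hc'X)
  have h3 := Subgroup.mul_mem _ (Subgroup.mem_sup_right (S := T ⊓ L) h2)
    (Subgroup.mem_sup_left h1)
  simpa using h3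

end Main

end ProfiniteCosets

/-! ### The verbal subgroup is virtually a subgroup of the class -/

open ProfiniteCosets in
theorem theorem1p1 (C : ProfiniteCosets.GroupClass.{u}) (hC : C.IsAdmissible)
    (w : FreeGroup ℕ) (hw : ProfiniteCosets.IsMultilinearCommutator w)
    (G : Type u) [Group G] [TopologicalSpace G] [IsTopologicalGroup G] [CompactSpace G]
    [TotallyDisconnectedSpace G] :
    C.Virtually (ProfiniteCosets.verbalSubgroup w G) ↔
      C.CountablyCovers (ProfiniteCosets.wordValues w G) := by
  classical
  have hWc : IsClosed (verbalSubgroup w G : Set G) := isClosed_closedSpan _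
  have hWcpt : CompactSpace (verbalSubgroup w G) := isCompact_iff_compactSpace.1 hWc.isCompact
  have hsub : wordValues w G ⊆ verbalSubgroup w G := subset_closedSpan _
  constructor
  · rintro ⟨N, hNn, hNc, hNf, hCN⟩
    have hK : IsClosed ((N.map (verbalSubgroup w G).subtype : Subgroup G) : Set G) :=
      (hNc.isCompact.image continuous_subtype_val).isClosed
    obtain ⟨f, hf⟩ := exists_surjective_nat (verbalSubgroup w G ⧸ N)
    refine ⟨fun i => ((f i).out : verbalSubgroup w G),
      fun _ => N.map (verbalSubgroup w G).subtype, fun _ => hK, fun _ =>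
        (hC.map_iff _ continuous_subtype_val (verbalSubgroup w G).subtype_injective hNc).1 hCN,
      fun x hx => ?_⟩
    obtain ⟨i, hi⟩ := hf ((⟨x, hsub hx⟩ : verbalSubgroup w G) : verbalSubgroup w G ⧸ N)
    refine Set.mem_iUnion.2 ⟨i, Set.mem_smul_set_iff_inv_smul_mem.2
      ⟨(f i).out⁻¹ * ⟨x, hsub hx⟩, QuotientGroup.eq.1 ?_, rfl⟩⟩
    rw [QuotientGroup.out_eq', hi]
  · intro hcov
    obtain ⟨s, hw⟩ := hw
    have hex : ∀ k, ∃ L : Subgroup G, L.Normal ∧ IsOpen (L : Set G) ∧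
        (k ∈ s → C (closedSpan (restrictedValues w {k} L))) := by
      intro k
      by_cases hk : k ∈ s
      · obtain ⟨L, h1, h2, h3⟩ := hw.exists_open_normal hC hcov _ {k} (by simpa using hk)
          (Finset.singleton_nonempty k) rfl
        exact ⟨L, h1, h2, fun _ => h3⟩
      · exact ⟨⊤, inferInstance, isOpen_univ, fun h => absurd h hk⟩
    choose L₀ hL₀n hL₀o hL₀C using hex
    obtain ⟨hLn, hLo⟩ := open_normal_finset_inf s L₀ fun k _ => ⟨hL₀n k, hL₀o k⟩
    set L := s.inf L₀
    set N : Subgroup G := s.sup fun k => closedSpan (restrictedValues w {k} L)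
    have hNN : C.NormalIn ⊤ N := by
      refine hC.normalIn_finset_sup isClosed_univ (hC.bot_mem hcov) _ _ fun k hk => ?_
      refine normalIn_top_closedSpan hLn (hC.of_le (isClosed_closedSpan _) (hL₀C k hk)
        (isClosed_closedSpan _) (closedSpan_le (isClosed_closedSpan _) ?_))
      exact (restrictedValues_mono w _ (Finset.inf_le hk)).trans (subset_closedSpan _)
    have hNn : N.Normal := ⟨fun x hx g => hNN.conj_mem g trivial x hx⟩
    have hNW : N ≤ verbalSubgroup w G := Finset.sup_le fun k _ => closedSpan_le hWc <| by
      rintro _ ⟨c, -, rfl⟩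
      exact hsub ⟨c, rfl⟩
    let π := QuotientGroup.mk' N
    have hπ : Function.Surjective π := QuotientGroup.mk'_surjective N
    have hfinL : Finite (G ⧸ L) := Subgroup.quotient_finite_of_isOpen L hLo
    have hLf : L.FiniteIndex := Subgroup.finiteIndex_of_finite_quotient
    have hLπ : (L.map π).FiniteIndex := finiteIndex_map hπ L
    have hfin : Finite (Subgroup.closure (wordValues w (G ⧸ N))) := by
      refine hw.finite_closure_wordValues (hLn.map π hπ) fun k hk c hc => ?_
      obtain ⟨c, hck, rfl⟩ := exists_lift_tuple hπ hc
      rw [← map_lift_apply]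
      refine (QuotientGroup.eq_one_iff _).2 (Finset.le_sup
        (f := fun k => closedSpan (restrictedValues w {k} L)) hk
        (subset_closedSpan _ ⟨_, ?_, rfl⟩))
      simpa using hck
    have hclosed : IsClosed (N : Set G) := hNN.isClosed
    -- The image of the verbal subgroup in `G ⧸ N` is finite.
    have hWle : verbalSubgroup w G ≤ (Subgroup.closure (wordValues w (G ⧸ N))).comap π := by
      refine closedSpan_le ?_ ?_
      · have hF := Set.toFinite (Subgroup.closure (wordValues w (G ⧸ N)) : Set (G ⧸ N))
        exact hF.isClosed.preimage QuotientGroup.continuous_mk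
      · rintro _ ⟨c, rfl⟩
        exact Subgroup.subset_closure ⟨_, (map_lift_apply π c w).symm⟩
    let φ : verbalSubgroup w G →* Subgroup.closure (wordValues w (G ⧸ N)) :=
      (π.comp (verbalSubgroup w G).subtype).codRestrict _ fun x => hWle x.2
    have hker : φ.ker = N.subgroupOf (verbalSubgroup w G) := by
      ext x
      rw [MonoidHom.mem_ker, Subgroup.mem_subgroupOf, ← QuotientGroup.eq_one_iff (N := N)]
      exact Subtype.ext_iff
    refine ⟨N.subgroupOf (verbalSubgroup w G), inferInstance,
      hclosed.preimage continuous_subtype_val, ?_, (hC.subgroupOf_iff hWc hclosed hNW).2 hNN.mem⟩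
    rw [← hker]
    exact Subgroup.finiteIndex_ker φ
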